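/- Let $n\ge 1$ and equip $\mathbb C^n$ with $\langle w,z\rangle=\sum_{j=1}^n w_j\overline{z_j}$, $|z|^2=\langle z,z\rangle$. Let $\psi:[0,\infty)\to[0,\infty)$ be a $C^3$-function with $\psi'(y)>0$, $\psi''(y)\ge 0$ and $\psi'''(y)\ge 0$ for all $y\ge 0$; if $n>1$, assume also that, with $\phi(y)=y\,\psi'(y)$, there is a real number $l<\tfrac12$ such that $$\phi''(y)=O\big(y^{-1/2}[\phi'(y)]^{1+l}\big)\qquad (y\to\infty).$$ Let $F_\psi^2$ be the Hilbert space of all holomorphic functions $f:\mathbb C^n\to\mathbb C$ with $\int_{\mathbb C^n}|f(z)|^2e^{-\psi(|z|^2)}\,d\mu(z)<\infty$, with the inner product $\langle f,g\rangle_\psi=\int_{\mathbb C^n} f(z)\overline{g(z)}\,e^{-\psi(|z|^2)}\,d\mu(z)$, where $\mu$ is Lebesgue measure on $\mathbb C^n$. For $\Gamma:\mathbb C^n\to\mathbb C^n$, the composition operator is $C_\Gamma f=f\circ\Gamma$; it is bounded on $F_\psi^2$ if $f\circ\Gamma\in F_\psi^2$ for all $f\in F_\psi^2$ and $\|C_\Gamma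 f\|\le M\|f\|$ for some constant $M$ and all $f\in F_\psi^2$. Theorem 2.1. Let $C_1,C_2$ be complex $n\times n$ matrices with operator norms (with respect to $|\cdot|$) $\|C_1\|\le 1$, $\|C_2\|\le 1$, let $D_1,D_2\in\mathbb C^n$, and put $\Gamma_1(z)=C_1z+D_1$, $\Gamma_2(z)=C_2z+D_2$. Assume that $C_{\Gamma_1}$ and $C_{\Gamma_2}$ are bounded on $F_\psi^2$. Then $C_{\Gamma_1}^*=C_{\Gamma_2}$ (Hilbert-space adjoint in $F_\psi^2$) if and only if $$D_1=0,\quad D_2=0\quad\text{and}\quad C_1^*=C_2,$$ where $C_1^*$ is the conjugate transpose of $C_1$. -/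

import Mathlib

open MeasureTheory Set Filter Topology Asymptotics
open scoped ENNReal ComplexConjugate InnerProductSpace

noncomputable section

namespace FockType

/-- Complex Euclidean `n`-space with its Hermitian norm. -/
abbrev Cn (n : ℕ) : Type := EuclideanSpace ℂ (Fin n)

/-- A weight: a `C³` function `ψ : [0, ∞) → [0, ∞)` with `ψ' > 0`, `ψ'' ≥ 0` and `ψ''' ≥ 0` on
`[0, ∞)` (derivatives at `0` are one-sided). The values of `toFun` on `(-∞, 0)` are irrelevant. -/
structure Weight where
  toFun : ℝ → ℝ
  nonneg' : ∀ y ∈ Ici (0 : ℝ), 0 ≤ toFun y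
  contDiffOn' : ContDiffOn ℝ 3 toFun (Ici 0)
  deriv_pos' : ∀ y ∈ Ici (0 : ℝ), 0 < derivWithin toFun (Ici 0) y
  deriv_two_nonneg' : ∀ y ∈ Ici (0 : ℝ), 0 ≤ iteratedDerivWithin 2 toFun (Ici 0) y
  deriv_three_nonneg' : ∀ y ∈ Ici (0 : ℝ), 0 ≤ iteratedDerivWithin 3 toFun (Ici 0) y

instance : CoeFun Weight (fun _ => ℝ → ℝ) := ⟨Weight.toFun⟩

/-- The function `φ(y) = y ψ'(y)` on `[0, ∞)`. -/
def Weight.phi (ψ : Weight) (y : ℝ) : ℝ := y * derivWithin ψ (Ici 0) y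

/-- The mild smoothness condition: for some real `l < 1/2`,
`φ''(y) = O(y^{-1/2} [φ'(y)]^{1+l})` as `y → ∞`, where `φ(y) = y ψ'(y)`. -/
def Weight.MildlySmooth (ψ : Weight) : Prop :=
  ∃ l : ℝ, l < 1 / 2 ∧
    (fun y : ℝ => iteratedDerivWithin 2 ψ.phi (Ici 0) y) =O[atTop]
      fun y : ℝ => y ^ (-(1 / 2) : ℝ) * (derivWithin ψ.phi (Ici 0) y) ^ (1 + l)

variable {n : ℕ} {ψ : Weight}

/-- The measure `exp (-ψ(|z|²)) dμ(z)` on `ℂⁿ`, with `μ` the Lebesgue measure. -/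
def Weight.measure (ψ : Weight) (n : ℕ) : Measure (Cn n) :=
  volume.withDensity fun z => ENNReal.ofReal (Real.exp (-ψ (‖z‖ ^ 2)))

/-- The entire functions `f : ℂⁿ → ℂ` with `∫ |f(z)|² exp (-ψ(|z|²)) dμ(z) < ∞`. -/
def fockSubmodule (n : ℕ) (ψ : Weight) : Submodule ℂ (Cn n → ℂ) where
  carrier := {f | Differentiable ℂ f ∧ MemLp f 2 (ψ.measure n)}
  zero_mem' := ⟨differentiable_const 0, MemLp.zero⟩
  add_mem' hf hg := ⟨hf.1.add hg.1, hf.2.add hg.2⟩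
  smul_mem' c _ hf := ⟨hf.1.const_smul c, hf.2.const_smul c⟩

/-- The Fock-type space `F_ψ²` on `ℂⁿ`; its elements are honest entire functions. -/
def FockSpace (n : ℕ) (ψ : Weight) : Type := ↥(fockSubmodule n ψ)

namespace FockSpace

instance : AddCommGroup (FockSpace n ψ) := inferInstanceAs (AddCommGroup ↥(fockSubmodule n ψ))
instance : Module ℂ (FockSpace n ψ) := inferInstanceAs (Module ℂ ↥(fockSubmodule n ψ))
instance : CoeFun (FockSpace n ψ) (fun _ => Cn n → ℂ) := ⟨Subtype.val⟩

/-- A function satisfying the defining conditions, as an element of the Fock-type space. -/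
def mk (f : Cn n → ℂ) (hf : f ∈ fockSubmodule n ψ) : FockSpace n ψ := ⟨f, hf⟩

theorem differentiable (f : FockSpace n ψ) : Differentiable ℂ f := f.2.1
theorem memLp (f : FockSpace n ψ) : MemLp f 2 (ψ.measure n) := f.2.2

@[ext] theorem ext {f g : FockSpace n ψ} (h : ∀ z, f z = g z) : f = g := Subtype.ext (funext h)

@[simp] theorem add_apply (f g : FockSpace n ψ) (z : Cn n) : (f + g) z = f z + g z := rfl
@[simp] theorem sub_apply (f g : FockSpace n ψ) (z : Cn n) : (f - g) z = f z - g z := rfl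
@[simp] theorem zero_apply (z : Cn n) : (0 : FockSpace n ψ) z = 0 := rfl
@[simp] theorem smul_apply (c : ℂ) (f : FockSpace n ψ) (z : Cn n) : (c • f) z = c * f z := rfl

/-- The inner product `∫ conj f(z) g(z) exp (-ψ(|z|²)) dμ(z)`, which in Mathlib's convention is
conjugate-linear in the first argument. -/
instance : Inner ℂ (FockSpace n ψ) := ⟨fun f g => ∫ z, conj (f z) * g z ∂ψ.measure n⟩

theorem inner_def (f g : FockSpace n ψ) : ⟪f, g⟫_ℂ = ∫ z, conj (f z) * g z ∂ψ.measure n := rfl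

/-- The class in `L²` of an element of the Fock-type space. -/
def toL2 : FockSpace n ψ →ₗ[ℂ] Lp ℂ 2 (ψ.measure n) where
  toFun f := f.memLp.toLp
  map_add' _ _ := rfl
  map_smul' _ _ := rfl

theorem coeFn_toL2 (f : FockSpace n ψ) : toL2 f =ᵐ[ψ.measure n] f := f.memLp.coeFn_toLp

theorem inner_toL2 (f g : FockSpace n ψ) : ⟪toL2 f, toL2 g⟫_ℂ = ⟪f, g⟫_ℂ := by
  rw [inner_def, L2.inner_def]
  refine integral_congr_ae ?_
  filter_upwards [coeFn_toL2 f, coeFn_toL2 g] with z hf hg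
  rw [hf, hg]
  simp [mul_comm]

end FockSpace

theorem Weight.continuous_comp (ψ : Weight) (n : ℕ) :
    Continuous fun z : Cn n => ψ (‖z‖ ^ 2) :=
  ψ.contDiffOn'.continuousOn.comp_continuous (by fun_prop) fun z => sq_nonneg ‖z‖

theorem Weight.volume_ac (ψ : Weight) (n : ℕ) : (volume : Measure (Cn n)) ≪ ψ.measure n := by
  refine withDensity_absolutelyContinuous' ?_ ?_
  · exact ((ψ.continuous_comp n).neg.rexp.measurable.ennreal_ofReal).aemeasurable
  · exact Eventually.of_forall fun z => by simp [Real.exp_pos]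

theorem FockSpace.toL2_injective : Function.Injective (toL2 : FockSpace n ψ → _) := by
  intro f g h
  have h1 : (f : Cn n → ℂ) =ᵐ[volume] g :=
    (ψ.volume_ac n).ae_le ((coeFn_toL2 f).symm.trans (h ▸ coeFn_toL2 g))
  exact Subtype.ext ((f.differentiable.continuous.ae_eq_iff_eq volume
    g.differentiable.continuous).1 h1)

namespace FockSpace

instance core : InnerProductSpace.Core ℂ (FockSpace n ψ) where
  conj_inner_symm f g := by
    rw [← inner_toL2, ← inner_toL2]; exact inner_conj_symm _ _
  re_inner_nonneg f := by
    rw [← inner_toL2]; exact inner_self_nonneg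
  add_left f g h := by
    rw [← inner_toL2, ← inner_toL2, ← inner_toL2, map_add]; exact inner_add_left _ _ _
  smul_left f g c := by
    rw [← inner_toL2, ← inner_toL2, map_smul]; exact inner_smul_left _ _ _
  definite f h := by
    rw [← inner_toL2, inner_self_eq_zero] at h
    exact toL2_injective (h.trans (map_zero _).symm)

instance : NormedAddCommGroup (FockSpace n ψ) := core.toNormedAddCommGroup
instance : InnerProductSpace ℂ (FockSpace n ψ) := .ofCore core.toCore

theorem norm_toL2 (f : FockSpace n ψ) : ‖toL2 f‖ = ‖f‖ := by
  rw [@norm_eq_sqrt_re_inner ℂ, @norm_eq_sqrt_re_inner ℂ, inner_toL2]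

theorem norm_eq (f : FockSpace n ψ) : ‖f‖ = (eLpNorm f 2 (ψ.measure n)).toReal := by
  rw [← norm_toL2]; exact Lp.norm_toLp _ f.memLp

end FockSpace
theorem integral_circle_eq {f : Cn n → ℂ} (hf : Differentiable ℂ f) (z w : Cn n) :
    ∫ θ in (0 : ℝ)..2 * Real.pi, f (z + Complex.exp (θ * Complex.I) • w) =
      (2 * Real.pi : ℝ) • f z := by
  have h := (show Differentiable ℂ fun t : ℂ => f (z + t • w) by fun_prop).diffContOnCl
    (s := Metric.ball 0 |1|) |>.circleAverage
  rw [Real.circleAverage_def] at h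
  simp only [circleMap, zero_add, zero_smul, add_zero, Complex.ofReal_one, one_mul] at h
  rw [← h, smul_inv_smul₀ (by positivity)]

theorem setIntegral_rotate (f : Cn n → ℂ) (z : Cn n) (c : ℂ) (hc : ‖c‖ = 1) :
    ∫ w in Metric.closedBall 0 1, f (z + c • w) = ∫ w in Metric.closedBall 0 1, f (z + w) := by
  have hc0 : c ≠ 0 := by rintro rfl; simp at hc
  let e : Cn n ≃ₗᵢ[ℝ] Cn n :=
    { toLinearEquiv := (LinearEquiv.smulOfNeZero ℂ (Cn n) c hc0).restrictScalars ℝ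
      norm_map' := fun x => by
        change ‖c • x‖ = ‖x‖
        rw [norm_smul, hc, one_mul] }
  have h := e.measurePreserving.setIntegral_preimage_emb
    e.toHomeomorph.measurableEmbedding (fun w => f (z + w)) (Metric.closedBall 0 1)
  have h2 : e ⁻¹' Metric.closedBall 0 1 = Metric.closedBall 0 1 := by
    ext x; simp
  rw [← h]
  change _ = ∫ w in e ⁻¹' Metric.closedBall 0 1, _
  rw [h2]
  rfl

/-- The mean value property on balls. -/
theorem setIntegral_closedBall_eq {f : Cn n → ℂ} (hf : Differentiable ℂ f) (z : Cn n) :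
    ∫ w in Metric.closedBall 0 1, f (z + w) =
      (volume (Metric.closedBall (0 : Cn n) 1)).toReal • f z := by
  have hpi : (2 * Real.pi : ℝ) ≠ 0 := by positivity
  have hc := hf.continuous
  have key : ∫ θ in (0 : ℝ)..2 * Real.pi, ∫ w in Metric.closedBall (0 : Cn n) 1,
      f (z + Complex.exp (θ * Complex.I) • w) =
      ∫ w in Metric.closedBall (0 : Cn n) 1, ∫ θ in (0 : ℝ)..2 * Real.pi,
        f (z + Complex.exp (θ * Complex.I) • w) := by
    simp only [intervalIntegral.integral_of_le (show (0 : ℝ) ≤ 2 * Real.pi by positivity)]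
    refine integral_integral_swap ?_
    rw [Measure.prod_restrict]
    refine IntegrableOn.mono_set (t := Icc 0 (2 * Real.pi) ×ˢ Metric.closedBall (0 : Cn n) 1) ?_
      (prod_mono Ioc_subset_Icc_self subset_rfl)
    refine ContinuousOn.integrableOn_compact (isCompact_Icc.prod (isCompact_closedBall _ _)) ?_
    exact Continuous.continuousOn (by unfold Function.uncurry; fun_prop)
  simp only [integral_circle_eq hf] at key
  simp only [setIntegral_rotate f z _ (Complex.norm_exp_ofReal_mul_I _)] at key
  rw [intervalIntegral.integral_const, setIntegral_const, sub_zero, smul_comm] at key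
  exact smul_right_injective _ hpi key

/-- Point evaluations are bounded, uniformly on bounded sets. -/
theorem FockSpace.exists_norm_apply_le (n : ℕ) (ψ : Weight) (R : ℝ) :
    ∃ C : ℝ, 0 ≤ C ∧ ∀ z : Cn n, ‖z‖ ≤ R → ∀ f : FockSpace n ψ, ‖f z‖ ≤ C * ‖f‖ := by
  obtain ⟨M, hM⟩ := (isCompact_closedBall (0 : Cn n) (R + 1)).bddAbove_image
    (ψ.continuous_comp n).continuousOn
  set B := Metric.closedBall (0 : Cn n) 1 with hB
  set V := (volume B) with hV
  have hV0 : V ≠ 0 := (Metric.measure_closedBall_pos _ _ one_pos).ne'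
  have hVt : V ≠ ∞ := measure_closedBall_lt_top.ne
  set a : ℝ≥0∞ := ENNReal.ofReal (Real.exp M) with ha
  have hle : volume.restrict (Metric.closedBall (0 : Cn n) (R + 1)) ≤ a • ψ.measure n := by
    refine Measure.le_iff.2 fun s hs => ?_
    rw [Measure.restrict_apply hs, Measure.smul_apply, smul_eq_mul, Weight.measure,
      withDensity_apply _ hs, ← lintegral_const_mul' _ _ ENNReal.ofReal_ne_top]
    calc volume (s ∩ Metric.closedBall (0 : Cn n) (R + 1))
        = ∫⁻ z in s ∩ Metric.closedBall (0 : Cn n) (R + 1), 1 := by simp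
      _ ≤ ∫⁻ z in s ∩ Metric.closedBall (0 : Cn n) (R + 1),
            a * ENNReal.ofReal (Real.exp (-ψ (‖z‖ ^ 2))) := by
          refine setLIntegral_mono' (hs.inter Metric.isClosed_closedBall.measurableSet) ?_
          intro z hz
          rw [ha, ← ENNReal.ofReal_mul (Real.exp_pos _).le, ← Real.exp_add,
            ENNReal.one_le_ofReal, Real.one_le_exp_iff]
          have := hM (mem_image_of_mem _ hz.2)
          linarith
      _ ≤ _ := lintegral_mono_set inter_subset_left
  set K : ℝ≥0∞ := a ^ (1 / 2 : ℝ) * V ^ (1 / 2 : ℝ) with hK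
  have hKt : K ≠ ∞ := ENNReal.mul_ne_top
    (ENNReal.rpow_ne_top_of_nonneg (by norm_num) ENNReal.ofReal_ne_top)
    (ENNReal.rpow_ne_top_of_nonneg (by norm_num) hVt)
  refine ⟨(V.toReal)⁻¹ * K.toReal, by positivity, fun z hz f => ?_⟩
  have hVpos : 0 < V.toReal := ENNReal.toReal_pos hV0 hVt
  rw [mul_assoc, inv_mul_eq_div, le_div_iff₀ hVpos, mul_comm]
  have hcont := f.differentiable.continuous
  have h1 : eLpNorm (fun w => f (z + w)) 1 (volume.restrict B) ≤ K * eLpNorm f 2 (ψ.measure n) := by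
    have h2 := eLpNorm_le_eLpNorm_mul_rpow_measure_univ (μ := volume.restrict B) (p := 1) (q := 2)
      (f := fun w => f (z + w)) one_le_two (by fun_prop)
    have h3 : eLpNorm (fun w => f (z + w)) 2 (volume.restrict B) ≤
        a ^ (1 / 2 : ℝ) * eLpNorm f 2 (ψ.measure n) := by
      have hmp : MeasurePreserving (fun w : Cn n => z + w) (volume.restrict B)
          (volume.restrict (Metric.closedBall z 1)) := by
        have := (measurePreserving_add_left volume z).restrict_preimage
          (s := Metric.closedBall z 1) Metric.isClosed_closedBall.measurableSet
        simpa [hB] using this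
      have h4 : eLpNorm (fun w => f (z + w)) 2 (volume.restrict B) =
          eLpNorm f 2 (volume.restrict (Metric.closedBall z 1)) :=
        eLpNorm_comp_measurePreserving hcont.aestronglyMeasurable hmp
      have h5 : volume.restrict (Metric.closedBall z 1) ≤ a • ψ.measure n := by
        refine (Measure.restrict_mono_set _ ?_).trans hle
        exact Metric.closedBall_subset_closedBall' (by rw [dist_zero_right]; linarith)
      rw [h4]
      refine (eLpNorm_mono_measure _ h5).trans ?_
      rw [eLpNorm_smul_measure_of_ne_top (by norm_num)]
      simp
    refine h2.trans ?_
    rw [Measure.restrict_apply_univ, hK]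
    calc _ ≤ a ^ (1 / 2 : ℝ) * eLpNorm f 2 (ψ.measure n) * V ^ (1 / 2 : ℝ) := by
          norm_num at h3 ⊢
          gcongr
      _ = _ := by ring
  have h6 : V.toReal * ‖f z‖ ≤ (eLpNorm (fun w => f (z + w)) 1 (volume.restrict B)).toReal := by
    have h7 := setIntegral_closedBall_eq f.differentiable z
    have h8 := norm_integral_le_lintegral_norm (μ := volume.restrict B) fun w => f (z + w)
    rw [h7, norm_smul, Real.norm_of_nonneg ENNReal.toReal_nonneg] at h8
    simpa [eLpNorm_one_eq_lintegral_enorm] using h8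
  rw [norm_eq, ← ENNReal.toReal_mul]
  exact h6.trans (ENNReal.toReal_mono (ENNReal.mul_ne_top hKt f.memLp.2.ne) h1)

/-- Cauchy's estimate on balls of radius `1`. -/
theorem norm_fderiv_le_of_forall {f : Cn n → ℂ} (hf : Differentiable ℂ f) {z : Cn n} {M : ℝ}
    (hM : ∀ w, ‖w‖ ≤ ‖z‖ + 1 → ‖f w‖ ≤ M) : ‖fderiv ℂ f z‖ ≤ M := by
  have hM0 : 0 ≤ M := (norm_nonneg _).trans (hM z (by linarith))
  refine ContinuousLinearMap.opNorm_le_of_unit_norm hM0 ?_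
  intro v hv
  have hd : HasDerivAt (fun t : ℂ => f (z + t • v)) (fderiv ℂ f z v) 0 := by
    have h1 : HasDerivAt (fun t : ℂ => z + t • v) v 0 := by
      simpa using ((hasDerivAt_id (0 : ℂ)).smul_const v).const_add z
    have h2 : HasFDerivAt f (fderiv ℂ f z) (z + (0 : ℂ) • v) := by
      simpa using (hf z).hasFDerivAt
    exact h2.comp_hasDerivAt 0 h1
  rw [← hd.deriv]
  have := Complex.norm_deriv_le_of_forall_mem_sphere_norm_le (c := 0) (R := 1) (C := M)
    (f := fun t : ℂ => f (z + t • v)) one_pos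
    (show Differentiable ℂ fun t : ℂ => f (z + t • v) by fun_prop).diffContOnCl ?_
  · simpa using this
  · intro t ht
    refine hM _ ((norm_add_le _ _).trans ?_)
    rw [norm_smul, hv, mul_one, mem_sphere_zero_iff_norm.1 ht]

theorem FockSpace.exists_norm_fderiv_le (n : ℕ) (ψ : Weight) (R : ℝ) :
    ∃ C : ℝ, 0 ≤ C ∧ ∀ z : Cn n, ‖z‖ ≤ R → ∀ f : FockSpace n ψ, ‖fderiv ℂ f z‖ ≤ C * ‖f‖ := by
  obtain ⟨C, hC0, hC⟩ := FockSpace.exists_norm_apply_le n ψ (R + 1)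
  refine ⟨C, hC0, fun z hz f => norm_fderiv_le_of_forall f.differentiable fun w hw => ?_⟩
  exact hC w (by linarith) f

/-- The Fock-type space is a Hilbert space. -/
instance : CompleteSpace (FockSpace n ψ) := by
  refine Metric.complete_of_cauchySeq_tendsto fun u hu => ?_
  have hsmall : ∀ C : ℝ, 0 ≤ C → ∀ ε > 0, ∃ N, ∀ k ≥ N, ∀ m ≥ N, C * ‖u k - u m‖ < ε := by
    intro C hC0 ε hε
    obtain ⟨N, hN⟩ := Metric.cauchySeq_iff.1 hu (ε / (C + 1)) (by positivity)
    refine ⟨N, fun k hk m hm => ?_⟩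
    have := hN k hk m hm
    rw [dist_eq_norm, lt_div_iff₀ (by positivity)] at this
    nlinarith [norm_nonneg (u k - u m)]
  have hval : ∀ z, ∃ l, Tendsto (fun k => u k z) atTop (𝓝 l) := by
    intro z
    obtain ⟨C, hC0, hC⟩ := FockSpace.exists_norm_apply_le n ψ ‖z‖
    refine cauchySeq_tendsto_of_complete (Metric.cauchySeq_iff.2 fun ε hε => ?_)
    obtain ⟨N, hN⟩ := hsmall C hC0 ε hε
    refine ⟨N, fun k hk m hm => ?_⟩
    rw [dist_eq_norm]
    exact (hC z le_rfl (u k - u m)).trans_lt (hN k hk m hm)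
  choose g hg using hval
  have hder : ∀ R : ℝ, UniformCauchySeqOn (fun k z => fderiv ℂ (u k) z) atTop
      (Metric.ball (0 : Cn n) R) := by
    intro R
    obtain ⟨C, hC0, hC⟩ := FockSpace.exists_norm_fderiv_le n ψ R
    refine Metric.uniformCauchySeqOn_iff.2 fun ε hε => ?_
    obtain ⟨N, hN⟩ := hsmall C hC0 ε hε
    refine ⟨N, fun k hk m hm z hz => ?_⟩
    rw [dist_eq_norm, ← fderiv_sub (u k).differentiable.differentiableAt
      (u m).differentiable.differentiableAt]
    exact (hC z (mem_ball_zero_iff.1 hz).le (u k - u m)).trans_lt (hN k hk m hm)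
  have hder' : ∀ z, ∃ l, Tendsto (fun k => fderiv ℂ (u k) z) atTop (𝓝 l) := fun z =>
    cauchySeq_tendsto_of_complete ((hder (‖z‖ + 1)).cauchySeq (by simp))
  choose g' hg' using hder'
  have hgd : Differentiable ℂ g := fun z =>
    (hasFDerivAt_of_tendstoUniformlyOn (s := Metric.ball (0 : Cn n) (‖z‖ + 1))
      Metric.isOpen_ball ((hder _).tendstoUniformlyOn_of_tendsto fun x _ => hg' x)
      (fun k x _ => ((u k).differentiable x).hasFDerivAt) (fun x _ => hg x)
      (x := z) (by simp)).differentiableAt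
  have hL : CauchySeq fun k => FockSpace.toL2 (u k) := by
    refine Metric.cauchySeq_iff.2 fun ε hε => ?_
    obtain ⟨N, hN⟩ := Metric.cauchySeq_iff.1 hu ε hε
    refine ⟨N, fun k hk m hm => ?_⟩
    rw [dist_eq_norm, ← map_sub, FockSpace.norm_toL2, ← dist_eq_norm]
    exact hN k hk m hm
  obtain ⟨G, hG⟩ := cauchySeq_tendsto_of_complete hL
  obtain ⟨ns, hns, hae⟩ := (tendstoInMeasure_of_tendsto_Lp hG).exists_seq_tendsto_ae
  have hgG : G =ᵐ[ψ.measure n] g := by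
    have hall : ∀ᵐ z ∂ψ.measure n, ∀ k, FockSpace.toL2 (u k) z = u k z :=
      ae_all_iff.2 fun k => FockSpace.coeFn_toL2 (u k)
    filter_upwards [hae, hall] with z h1 h2
    simp only [h2] at h1
    exact tendsto_nhds_unique h1 ((hg z).comp hns.tendsto_atTop)
  let g₀ : FockSpace n ψ := ⟨g, hgd, (memLp_congr_ae hgG).1 (Lp.memLp G)⟩
  have hg₀ : FockSpace.toL2 g₀ = G :=
    Lp.ext ((FockSpace.coeFn_toL2 g₀).trans hgG.symm)
  refine ⟨g₀, tendsto_iff_norm_sub_tendsto_zero.2 ?_⟩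
  have h := tendsto_iff_norm_sub_tendsto_zero.1 hG
  rw [← hg₀] at h
  simpa only [← map_sub, FockSpace.norm_toL2] using h

/-- The symbol `Γ` induces a bounded composition operator on the Fock-type space: `f ∘ Γ` belongs
to the space whenever `f` does, and `‖f ∘ Γ‖ ≤ M ‖f‖` for some constant `M`. -/
structure IsBoundedSymbol (ψ : Weight) (Γ : Cn n → Cn n) : Prop where
  mem : ∀ f : FockSpace n ψ, (fun z => f (Γ z)) ∈ fockSubmodule n ψ
  bound : ∃ M : ℝ, ∀ f : FockSpace n ψ,
    ‖FockSpace.mk (fun z => f (Γ z)) (mem f)‖ ≤ M * ‖f‖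

/-- The bounded composition operator `C_Γ f = f ∘ Γ` on the Fock-type space. -/
def compositionOperator (ψ : Weight) (Γ : Cn n → Cn n) (hΓ : IsBoundedSymbol ψ Γ) :
    FockSpace n ψ →L[ℂ] FockSpace n ψ :=
  LinearMap.mkContinuousOfExistsBound
    { toFun := fun f => FockSpace.mk (fun z => f (Γ z)) (hΓ.mem f)
      map_add' := fun _ _ => rfl
      map_smul' := fun _ _ => rfl } hΓ.bound

@[simp] theorem compositionOperator_apply (Γ : Cn n → Cn n) (hΓ : IsBoundedSymbol ψ Γ)
    (f : FockSpace n ψ) (z : Cn n) : compositionOperator ψ Γ hΓ f z = f (Γ z) := rfl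

/-- The affine map `z ↦ C z + D` of `ℂⁿ`. -/
def affineMap (C : Matrix (Fin n) (Fin n) ℂ) (D : Cn n) (z : Cn n) : Cn n :=
  Matrix.toEuclideanCLM (𝕜 := ℂ) C z + D

end FockType

end

/-!
The proof works with the reproducing kernel `K z`, the vector of `F_ψ²` with `⟪K z, f⟫ = f z`, and
rests on the identity `K z (A w) = K (Aᴴ z) w`, valid for *every* square matrix `A`
(`reproducingKernel_matrix`): it expresses that the kernel is a function of `⟨w, z⟩` alone.

For unitary `A` the identity holds because the measure `exp (-ψ(|z|²)) dμ(z)` is invariant under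
unitary maps. The matrices satisfying it form a submonoid `kernelSubmonoid`, and for fixed `z`, `w`
both sides of the identity are holomorphic in `A`, so that an affine family `A + t B` lies in the
submonoid for all complex `t` as soon as it does so for `t` in a nontrivial connected set
(`add_smul_mem_kernelSubmonoid`). Applied with `t` in the unit circle, this gives the diagonal
matrices; conjugating by unitaries, the Hermitian ones; and applied to `H₁ + t H₂` with `t` real and
`H₁`, `H₂` Hermitian, it gives at `t = i` all matrices.

Since `C_Γ^* (K z) = K (Γ z)` and a function is determined by its products with the kernels, the
equation `C_{Γ₁}^* = C_{Γ₂}` says `K (Γ₁ z) w = K z (Γ₂ w)` for all `z`, `w`. If `D₁ = D₂ = 0` and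
`C₁ᴴ = C₂` this is the identity for `A = C₂`. Conversely, the identity for `A = 0` shows that `K 0`
is constant, so that `z = 0` yields `K D₁ = K 0` and `w = 0` yields `K D₂ = K 0`; then the
equation becomes `K (C₁ z) = K (C₂ᴴ z)`. Evaluation at a point determines the point, because the
coordinate functions belong to `F_ψ²`: by convexity `ψ` grows at least linearly, so the weight is
bounded by a Gaussian. Hence `D₁ = D₂ = 0` and `C₁ = C₂ᴴ`.
-/

open MeasureTheory Set Filter Topology
open scoped ENNReal ComplexConjugate InnerProductSpace Matrix

noncomputable section

namespace FockType

variable {n : ℕ} {ψ : Weight}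

/-! ### Growth of the weight and linear functions -/

theorem Weight.convexOn (ψ : Weight) : ConvexOn ℝ (Ici 0) ψ := by
  have hu : UniqueDiffOn ℝ (Ici (0 : ℝ)) := uniqueDiffOn_Ici 0
  have hd1 : DifferentiableOn ℝ (derivWithin ψ (Ici 0)) (Ici 0) := by
    have := ψ.contDiffOn'.differentiableOn_iteratedDerivWithin (m := 1) (by norm_num) hu
    rwa [iteratedDerivWithin_one] at this
  refine convexOn_of_hasDerivWithinAt2_nonneg (f' := derivWithin ψ (Ici 0))
    (f'' := iteratedDerivWithin 2 ψ (Ici 0)) (convex_Ici 0) ψ.contDiffOn'.continuousOn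
    (fun x hx => ?_) (fun x hx => ?_) fun x hx => ψ.deriv_two_nonneg' x (interior_subset hx)
  · exact ((ψ.contDiffOn'.differentiableOn (by norm_num)) x
      (interior_subset hx)).hasDerivWithinAt.mono interior_subset
  · have := (hd1 x (interior_subset hx)).hasDerivWithinAt.mono interior_subset
    rw [← iteratedDerivWithin_one, ← iteratedDerivWithin_succ] at this
    rwa [← iteratedDerivWithin_one]

theorem Weight.linear_growth (ψ : Weight) :
    ∃ a : ℝ, 0 < a ∧ ∀ y : ℝ, 0 ≤ y → a * y ≤ ψ y := by
  refine ⟨derivWithin ψ (Ici 0) 0, ψ.deriv_pos' 0 self_mem_Ici, fun y hy => ?_⟩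
  rcases hy.eq_or_lt with rfl | hy
  · simpa using ψ.nonneg' 0 self_mem_Ici
  have h := ψ.convexOn.derivWithin_le_slope self_mem_Ici hy.le hy
    ((ψ.contDiffOn'.differentiableOn (by norm_num)) 0 self_mem_Ici)
  rw [slope_def_field, sub_zero, le_div_iff₀ hy] at h
  linarith [ψ.nonneg' 0 self_mem_Ici]

theorem integrable_exp_neg_mul_sq_norm (n : ℕ) {a : ℝ} (ha : 0 < a) :
    Integrable fun z : Cn n => Real.exp (-a * ‖z‖ ^ 2) := by
  have h := (GaussianFourier.integrable_cexp_neg_mul_sq_norm_add (b := (a : ℂ)) (V := Cn n)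
    (by simpa using ha) 0 0).norm
  refine h.congr (Eventually.of_forall fun z => ?_)
  simp [Complex.norm_exp, ← Complex.ofReal_pow]

theorem clm_mem_fockSubmodule (ψ : Weight) (L : Cn n →L[ℂ] ℂ) :
    (fun z => L z) ∈ fockSubmodule n ψ := by
  refine ⟨L.differentiable, ?_⟩
  have hexp : Continuous fun z : Cn n => Real.exp (-ψ (‖z‖ ^ 2)) :=
    (ψ.continuous_comp n).neg.rexp
  rw [memLp_two_iff_integrable_sq_norm L.continuous.aestronglyMeasurable, Weight.measure,
    integrable_withDensity_iff_integrable_smul' (hexp.measurable.ennreal_ofReal) (by simp)]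
  obtain ⟨a, ha, hψ⟩ := ψ.linear_growth
  refine ((integrable_exp_neg_mul_sq_norm n (half_pos ha)).const_mul (‖L‖ ^ 2 * (2 / a))).mono'
    ?_ (Eventually.of_forall fun z => ?_)
  · simp only [ENNReal.toReal_ofReal (Real.exp_pos _).le, smul_eq_mul]
    exact (hexp.mul (L.continuous.norm.pow 2)).aestronglyMeasurable
  rw [ENNReal.toReal_ofReal (Real.exp_pos _).le, smul_eq_mul,
    Real.norm_of_nonneg (by positivity)]
  have h1 : ‖L z‖ ^ 2 ≤ ‖L‖ ^ 2 * ‖z‖ ^ 2 := by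
    rw [← mul_pow]; gcongr; exact L.le_opNorm z
  have h2 : ‖z‖ ^ 2 ≤ 2 / a * Real.exp (a / 2 * ‖z‖ ^ 2) := by
    have := Real.add_one_le_exp (a / 2 * ‖z‖ ^ 2)
    rw [div_mul_eq_mul_div, le_div_iff₀ ha]
    linarith
  calc Real.exp (-ψ (‖z‖ ^ 2)) * ‖L z‖ ^ 2
      ≤ Real.exp (-(a * ‖z‖ ^ 2)) * (‖L‖ ^ 2 * (2 / a * Real.exp (a / 2 * ‖z‖ ^ 2))) := by
        gcongr
        · exact hψ _ (sq_nonneg _)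
        · exact h1.trans (by gcongr)
    _ = ‖L‖ ^ 2 * (2 / a) * Real.exp (-(a / 2) * ‖z‖ ^ 2) := by
        rw [show -(a / 2) * ‖z‖ ^ 2 = -(a * ‖z‖ ^ 2) + a / 2 * ‖z‖ ^ 2 by ring, Real.exp_add]
        ring

/-- The functions of `F_ψ²` separate points; linear functions already do. -/
theorem eq_of_forall_apply_eq {x y : Cn n} (h : ∀ f : FockSpace n ψ, f x = f y) : x = y := by
  ext i
  exact h ⟨_, clm_mem_fockSubmodule ψ (EuclideanSpace.proj i)⟩

/-! ### The reproducing kernel -/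

/-- The evaluation functional `f ↦ f z`. -/
def evalCLM (ψ : Weight) (z : Cn n) : StrongDual ℂ (FockSpace n ψ) :=
  LinearMap.mkContinuousOfExistsBound
    { toFun := fun f => f z
      map_add' := fun _ _ => rfl
      map_smul' := fun _ _ => rfl }
    (let ⟨C, _, hC⟩ := FockSpace.exists_norm_apply_le n ψ ‖z‖
     ⟨C, hC z le_rfl⟩)

/-- The reproducing kernel of `F_ψ²` at `z`: the Riesz representative of evaluation at `z`. -/
def reproducingKernel (ψ : Weight) (z : Cn n) : FockSpace n ψ :=
  (InnerProductSpace.toDual ℂ (FockSpace n ψ)).symm (evalCLM ψ z)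

theorem inner_reproducingKernel (z : Cn n) (f : FockSpace n ψ) :
    ⟪reproducingKernel ψ z, f⟫_ℂ = f z :=
  InnerProductSpace.toDual_symm_apply

theorem reproducingKernel_conj (z w : Cn n) :
    conj (reproducingKernel ψ z w) = reproducingKernel ψ w z := by
  rw [← inner_reproducingKernel w, inner_conj_symm, inner_reproducingKernel]

theorem reproducingKernel_injective :
    Function.Injective (reproducingKernel ψ : Cn n → FockSpace n ψ) := fun x y h =>
  eq_of_forall_apply_eq fun f => by
    rw [← inner_reproducingKernel, h, inner_reproducingKernel]

theorem adjoint_compositionOperator_reproducingKernel {Γ : Cn n → Cn n}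
    (hΓ : IsBoundedSymbol ψ Γ) (z : Cn n) :
    ContinuousLinearMap.adjoint (compositionOperator ψ Γ hΓ) (reproducingKernel ψ z) =
      reproducingKernel ψ (Γ z) := by
  refine ext_inner_right ℂ fun f => ?_
  rw [ContinuousLinearMap.adjoint_inner_left, inner_reproducingKernel, inner_reproducingKernel,
    compositionOperator_apply]

/-- The adjoint of a composition operator is a composition operator exactly when the kernel
intertwines the two symbols. -/
theorem adjoint_compositionOperator_eq_iff {Γ₁ Γ₂ : Cn n → Cn n}
    (h₁ : IsBoundedSymbol ψ Γ₁) (h₂ : IsBoundedSymbol ψ Γ₂) :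
    ContinuousLinearMap.adjoint (compositionOperator ψ Γ₁ h₁) = compositionOperator ψ Γ₂ h₂ ↔
      ∀ z w, reproducingKernel ψ (Γ₁ z) w = reproducingKernel ψ z (Γ₂ w) := by
  constructor
  · intro h z w
    rw [← adjoint_compositionOperator_reproducingKernel h₁, h, compositionOperator_apply]
  · intro h
    -- The reversed equation identifies `C_{Γ₂}^* (K w)` with `C_{Γ₁} (K w)` for every `w`.
    refine ContinuousLinearMap.ext fun f => FockSpace.ext fun w => ?_
    rw [compositionOperator_apply, ← inner_reproducingKernel w,
      ContinuousLinearMap.adjoint_inner_right, ← inner_reproducingKernel (Γ₂ w) f]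
    congr 1
    refine FockSpace.ext fun z => ?_
    rw [compositionOperator_apply, ← reproducingKernel_conj, h, reproducingKernel_conj]

/-! ### Invariance under unitary maps -/

theorem measurePreserving_weight (ψ : Weight) (e : Cn n ≃ₗᵢ[ℂ] Cn n) :
    MeasurePreserving e (ψ.measure n) (ψ.measure n) := by
  have hv : MeasurePreserving e (volume : Measure (Cn n)) volume := by
    let e' : Cn n ≃ₗᵢ[ℝ] Cn n :=
      { toLinearEquiv := e.toLinearEquiv.restrictScalars ℝ
        norm_map' := e.norm_map }
    exact e'.measurePreserving
  refine ⟨e.continuous.measurable, Measure.ext fun s hs => ?_⟩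
  rw [Measure.map_apply e.continuous.measurable hs, Weight.measure,
    withDensity_apply _ hs, withDensity_apply _ (e.continuous.measurable hs),
    ← hv.setLIntegral_comp_preimage_emb e.toHomeomorph.measurableEmbedding _ s]
  simp only [e.norm_map]

/-- Composition with a linear isometry. -/
def FockSpace.compIsometry (e : Cn n ≃ₗᵢ[ℂ] Cn n) (f : FockSpace n ψ) : FockSpace n ψ :=
  ⟨fun z => f (e z), f.differentiable.comp e.toContinuousLinearEquiv.differentiable,
    f.memLp.comp_measurePreserving (measurePreserving_weight ψ e)⟩

theorem FockSpace.inner_compIsometry (e : Cn n ≃ₗᵢ[ℂ] Cn n) (f g : FockSpace n ψ) :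
    ⟪f.compIsometry e, g.compIsometry e⟫_ℂ = ⟪f, g⟫_ℂ :=
  (measurePreserving_weight ψ e).integral_comp e.toHomeomorph.measurableEmbedding
    fun z => conj (f z) * g z

theorem reproducingKernel_isometry (e : Cn n ≃ₗᵢ[ℂ] Cn n) (z w : Cn n) :
    reproducingKernel ψ z (e w) = reproducingKernel ψ (e.symm z) w := by
  suffices h : (reproducingKernel ψ z).compIsometry e = reproducingKernel ψ (e.symm z) from
    congrArg (fun f : FockSpace n ψ => f w) h
  refine ext_inner_right ℂ fun f => ?_
  have hf : (f.compIsometry e.symm).compIsometry e = f :=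
    FockSpace.ext fun x => congrArg f (e.symm_apply_apply x)
  rw [← hf, FockSpace.inner_compIsometry, hf, inner_reproducingKernel, inner_reproducingKernel]
  rfl

/-! ### The kernel depends only on the Hermitian product -/

/-- The matrices `A` with `K z (A w) = K (Aᴴ z) w` for all `z` and `w`. -/
def kernelSubmonoid (n : ℕ) (ψ : Weight) : Submonoid (Matrix (Fin n) (Fin n) ℂ) where
  carrier := {A | ∀ z w : Cn n, reproducingKernel ψ z (Matrix.toEuclideanCLM (𝕜 := ℂ) A w) =
    reproducingKernel ψ (Matrix.toEuclideanCLM (𝕜 := ℂ) Aᴴ z) w}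
  one_mem' z w := by simp
  mul_mem' {A B} hA hB z w := by
    rw [Matrix.conjTranspose_mul, map_mul, map_mul, mul_apply_eq_comp, hA, hB,
      mul_apply_eq_comp]

theorem unitary_mem_kernelSubmonoid {U : Matrix (Fin n) (Fin n) ℂ}
    (hU : U ∈ Matrix.unitaryGroup (Fin n) ℂ) : U ∈ kernelSubmonoid n ψ := by
  intro z w
  let u : unitary (Cn n →L[ℂ] Cn n) :=
    ⟨Matrix.toEuclideanCLM (𝕜 := ℂ) U, Unitary.map_mem (Matrix.toEuclideanCLM (𝕜 := ℂ)) hU⟩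
  have h := reproducingKernel_isometry (ψ := ψ) (Unitary.linearIsometryEquiv u) z w
  have hs : (Unitary.linearIsometryEquiv u).symm z =
      Matrix.toEuclideanCLM (𝕜 := ℂ) Uᴴ z := by
    rw [← Matrix.star_eq_conjTranspose, map_star]
    rfl
  rw [hs] at h
  exact h

/-- Analytic continuation along a complex line of matrices. -/
theorem add_smul_mem_kernelSubmonoid {A B : Matrix (Fin n) (Fin n) ℂ} {s : Set ℂ}
    (hs : IsPreconnected s) (hs' : s.Nontrivial)
    (h : ∀ t ∈ s, A + t • B ∈ kernelSubmonoid n ψ) (t : ℂ) :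
    A + t • B ∈ kernelSubmonoid n ψ := by
  intro z w
  let T := Matrix.toEuclideanCLM (𝕜 := ℂ) (n := Fin n)
  -- The right-hand side of the identity is `K w (Aᴴ z + conj t • Bᴴ z)` conjugated; the two
  -- conjugations make it holomorphic in `t`.
  let F : ℂ → ℂ := fun t => reproducingKernel ψ z (T A w + t • T B w)
  let g : ℂ → ℂ := fun t => reproducingKernel ψ w (T Aᴴ z + t • T Bᴴ z)
  let G : ℂ → ℂ := conj ∘ g ∘ conj
  have hF : Differentiable ℂ F :=
    (reproducingKernel ψ z).differentiable.comp (by fun_prop)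
  have hg : Differentiable ℂ g :=
    (reproducingKernel ψ w).differentiable.comp (by fun_prop)
  have hG : Differentiable ℂ G := fun t => by
    have := (hg (conj t)).conj_conj
    rwa [Complex.conj_conj] at this
  have hFG : ∀ t, A + t • B ∈ {A : Matrix (Fin n) (Fin n) ℂ | reproducingKernel ψ z (T A w) =
      reproducingKernel ψ (T Aᴴ z) w} ↔ F t = G t := by
    intro t
    simp [F, G, g, T, reproducingKernel_conj]
  obtain ⟨t₀, ht₀⟩ := hs'.nonempty
  have hacc := accPt_iff_frequently_nhdsNE.1 (hs.preperfect_of_nontrivial hs' t₀ ht₀)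
  have hEq : F = G := AnalyticOnNhd.eq_of_frequently_eq
    (fun x _ => hF.analyticAt x) (fun x _ => hG.analyticAt x)
    (hacc.mono fun t ht => (hFG t).1 (h t ht z w))
  exact (hFG t).2 (congrFun hEq t)

theorem diagonal_mem_kernelSubmonoid (d : Fin n → ℂ) :
    Matrix.diagonal d ∈ kernelSubmonoid n ψ := by
  have hsingle : ∀ (i : Fin n) (t : ℂ),
      Matrix.diagonal (Pi.mulSingle i t) ∈ kernelSubmonoid n ψ := by
    intro i
    have hd : ∀ t : ℂ, Matrix.diagonal (Pi.mulSingle i t) =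
        Matrix.diagonal (Pi.mulSingle i (0 : ℂ)) + t • Matrix.diagonal (Pi.single i 1) := by
      intro t
      rw [← Matrix.diagonal_smul, Matrix.diagonal_add]
      congr 1
      ext j
      rcases eq_or_ne j i with rfl | hj
      · simp
      · simp [hj]
    intro t
    rw [hd]
    -- For `t` on the unit circle this diagonal matrix is unitary.
    refine add_smul_mem_kernelSubmonoid (s := Metric.sphere 0 1)
      (isPreconnected_sphere (by simp [Complex.rank_real_complex]) 0 1)
      ⟨1, by simp, -1, by simp, by norm_num [Complex.ext_iff]⟩ (fun t ht => ?_) t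
    rw [← hd]
    refine unitary_mem_kernelSubmonoid (Matrix.mem_unitaryGroup_iff.2 ?_)
    rw [Matrix.star_eq_conjTranspose, Matrix.diagonal_conjTranspose, Matrix.diagonal_mul_diagonal,
      ← Matrix.diagonal_one]
    congr 1
    ext j
    rcases eq_or_ne j i with rfl | hj
    · have : t * conj t = 1 := by
        rw [Complex.mul_conj, Complex.normSq_eq_norm_sq, mem_sphere_zero_iff_norm.1 ht]
        simp
      simpa using this
    · simp [hj]
  have hprod : ∏ i, Pi.mulSingle i (d i) ∈
      (kernelSubmonoid n ψ).comap (Matrix.diagonalRingHom (Fin n) ℂ) :=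
    prod_mem fun i _ => hsingle i (d i)
  rwa [Finset.univ_prod_mulSingle] at hprod

theorem isHermitian_mem_kernelSubmonoid {H : Matrix (Fin n) (Fin n) ℂ} (hH : H.IsHermitian) :
    H ∈ kernelSubmonoid n ψ := by
  rw [hH.spectral_theorem, Unitary.conjStarAlgAut_apply]
  exact mul_mem (mul_mem (unitary_mem_kernelSubmonoid hH.eigenvectorUnitary.2)
    (diagonal_mem_kernelSubmonoid _))
    (unitary_mem_kernelSubmonoid (star hH.eigenvectorUnitary).2)

theorem kernelSubmonoid_eq_top : kernelSubmonoid n ψ = ⊤ := by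
  refine eq_top_iff.2 fun A _ => ?_
  have h := add_smul_mem_kernelSubmonoid (ψ := ψ) (A := (realPart A : Matrix (Fin n) (Fin n) ℂ))
    (B := (imaginaryPart A : Matrix (Fin n) (Fin n) ℂ)) (s := range ((↑) : ℝ → ℂ))
    (isPreconnected_range Complex.continuous_ofReal)
    ⟨0, ⟨0, by simp⟩, 1, ⟨1, by simp⟩, zero_ne_one⟩ ?_ Complex.I
  · rwa [realPart_add_I_smul_imaginaryPart] at h
  · rintro _ ⟨t, rfl⟩
    refine isHermitian_mem_kernelSubmonoid (IsSelfAdjoint.add (realPart A).2 ?_)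
    exact IsSelfAdjoint.smul (Complex.conj_ofReal t) (imaginaryPart A).2

/-- Over unitary `A` this says that `K z w` is invariant under `(z, w) ↦ (A z, A w)`; its validity
for all `A` expresses that `K z w` is a function of `⟨w, z⟩`. -/
theorem reproducingKernel_matrix (A : Matrix (Fin n) (Fin n) ℂ) (z w : Cn n) :
    reproducingKernel ψ z (Matrix.toEuclideanCLM (𝕜 := ℂ) A w) =
      reproducingKernel ψ (Matrix.toEuclideanCLM (𝕜 := ℂ) Aᴴ z) w :=
  (kernelSubmonoid_eq_top.ge : _ ≤ kernelSubmonoid n ψ) (Submonoid.mem_top A) z w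

theorem reproducingKernel_zero_apply (w : Cn n) :
    reproducingKernel ψ 0 w = reproducingKernel ψ (0 : Cn n) 0 := by
  simpa using (reproducingKernel_matrix (ψ := ψ) 0 0 w).symm

theorem reproducingKernel_apply_zero (z : Cn n) :
    reproducingKernel ψ z 0 = reproducingKernel ψ (0 : Cn n) 0 := by
  rw [← reproducingKernel_conj, reproducingKernel_zero_apply, reproducingKernel_conj]

end FockType

end

open FockType in
theorem theorem2p1 (n : ℕ) (hn : 1 ≤ n) (ψ : FockType.Weight)
    (hψ : 1 < n → ψ.MildlySmooth)
    (C₁ C₂ : Matrix (Fin n) (Fin n) ℂ) (D₁ D₂ : EuclideanSpace ℂ (Fin n))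
    (hC₁ : ‖Matrix.toEuclideanCLM (𝕜 := ℂ) C₁‖ ≤ 1)
    (hC₂ : ‖Matrix.toEuclideanCLM (𝕜 := ℂ) C₂‖ ≤ 1)
    (h₁ : FockType.IsBoundedSymbol ψ (FockType.affineMap C₁ D₁))
    (h₂ : FockType.IsBoundedSymbol ψ (FockType.affineMap C₂ D₂)) :
    ContinuousLinearMap.adjoint
        (FockType.compositionOperator ψ (FockType.affineMap C₁ D₁) h₁) =
      FockType.compositionOperator ψ (FockType.affineMap C₂ D₂) h₂ ↔
    D₁ = 0 ∧ D₂ = 0 ∧ C₁.conjTranspose = C₂ := by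
  rw [adjoint_compositionOperator_eq_iff]
  simp only [affineMap]
  constructor
  · intro h
    have hD₁ : D₁ = 0 := by
      refine reproducingKernel_injective (ψ := ψ) (FockSpace.ext fun w => ?_)
      have := h 0 w
      rw [map_zero, zero_add] at this
      rw [this, reproducingKernel_zero_apply, reproducingKernel_zero_apply w]
    have hD₂ : D₂ = 0 := by
      refine reproducingKernel_injective (ψ := ψ) (FockSpace.ext fun z => ?_)
      have := h z 0
      rw [map_zero, zero_add, reproducingKernel_apply_zero] at this
      rw [← reproducingKernel_conj, ← this, reproducingKernel_conj,
        reproducingKernel_zero_apply z]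
    refine ⟨hD₁, hD₂, ?_⟩
    subst hD₁ hD₂
    simp only [add_zero, reproducingKernel_matrix C₂] at h
    have hC : C₁ = C₂.conjTranspose := (Matrix.toEuclideanCLM (𝕜 := ℂ)).injective
      (ContinuousLinearMap.ext fun z =>
        reproducingKernel_injective (ψ := ψ) (FockSpace.ext fun w => h z w))
    rw [hC, Matrix.conjTranspose_conjTranspose]
  · rintro ⟨rfl, rfl, rfl⟩ z w
    rw [add_zero, add_zero, reproducingKernel_matrix, Matrix.conjTranspose_conjTranspose]
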